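/- **Setting.** Let $A,D\in\mathbb C^{n\times n}$, $\lambda_0\in\mathbb C$, and let $k\ge1$, $s_1,\dots,s_{k-1}\ge 0$, $s_k>0$ be integers. Let $[\Xi\ \ \Xi_c]\in\mathbb C^{n\times n}$ be invertible, $[\Sigma\ \ \Sigma_c]=[\Xi\ \ \Xi_c]^{-*}$, and $$A[\Xi\ \ \Xi_c]=[\Xi\ \ \Xi_c]\begin{bmatrix}\lambda_0I+N&0\\0&A_{22}\end{bmatrix},\qquad N=\operatorname{diag}(N_1,\dots,N_k),\qquad \lambda_0\notin\Lambda(A_{22}),$$ where $N_j$ is the $j\times j$ block matrix with blocks $I_{s_j}$ on the first block superdiagonal and zero blocks elsewhere (void if $s_j=0$). Partition $\Xi=[\Xi_1,\dots,\Xi_k]$, $\Xi_j=[\Xi_{j1},\dots,\Xi_{jj}]$, $\Sigma=[\Sigma_1,\dots,\Sigma_k]$, $\Sigma_j=[\Sigma_{j1},\dots,\Sigma_{jj}]$ accordingly, each $\Xi_{j\ell},\Sigma_{j\ell}$ having $s_j$ columns. Put, for $1\le i\le k$, $$\tilde\Xi_i=[\Xi_{i1},\Xi_{i+1,1},\dots,\Xi_{k1}],\qquad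 \tilde\Sigma_i=[\Sigma_{ii},\Sigma_{i+1,i+1},\dots,\Sigma_{kk}],\qquad W_i=\tilde\Sigma_i^*D\,\tilde\Xi_i .$$ Fix $\rho\in\{1,\dots,k\}$ and assume that $W_1,\dots,W_\rho$ are invertible and, if $\rho<k$, that $W_{\rho+1}$ is invertible. Set $$G_\rho^{(\rho)}=-W_{\rho+1}^{-1}\,\tilde\Sigma_{\rho+1}^*D\,\Xi_{\rho1},\qquad S_\rho=\Sigma_{\rho\rho}^*D\,\Xi_{\rho1}+\Sigma_{\rho\rho}^*D\,\tilde\Xi_{\rho+1}G_\rho^{(\rho)},$$ where for $\rho=k$ the matrix $G_\rho^{(\rho)}$ is void and $S_k=\Sigma_{kk}^*D\,\Xi_{k1}$. **Claim.** Let $\gamma^{(\rho)}$ be a simple eigenvalue of $S_\rho$ (algebraic multiplicity one), let $S_\rho\varphi=\gamma^{(\rho)}\varphi$ with $\varphi\ne0$, and let $\mu^{(\rho)}\in\mathbb C$ satisfy $(\mu^{(\rho)})^\rho=\gamma^{(\rho)}$. Then for all sufficiently small $t>0$ the matrix $A+tD$ has an eigenvalue $\lambda=\lambda(t)$ with a corresponding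 eigenvector $h=h(t)$ such that, as $t\to0^+$, $$\lambda=\lambda_0+t^{1/\rho}\mu^{(\rho)}+O(t^{2/\rho}),\qquad h=\tilde\Xi_\rho\begin{bmatrix}\varphi\\G_\rho^{(\rho)}\varphi\end{bmatrix}+\sum_{i=1}^k\Xi_ih_i+O(t),$$ where $h_i=h_i(t)$ consists of $i$ blocks of length $s_i$ and, blockwise, $$h_\rho=\begin{bmatrix}0\\(t^{1/\rho}\mu^{(\rho)})\varphi\\\vdots\\(t^{1/\rho}\mu^{(\rho)})^{\rho-1}\varphi\end{bmatrix}+O\left(\begin{bmatrix}t^{1/\rho}\\t^{2/\rho}\\\vdots\\t\end{bmatrix}\right),$$ $$h_i=O\left(\begin{bmatrix}t^{1-i/\rho}&t^{1-(i-1)/\rho}&\cdots&t^{1-1/\rho}\end{bmatrix}^T\right)\quad(1\le i\le\rho-1),$$ $$h_i=O\left(\begin{bmatrix}t^{1/\rho}&t^{1/\rho}&t^{2/\rho}&\cdots&t^{1-1/\rho}&t&\cdots&t\end{bmatrix}^T\right)\quad(\rho+1\le i\le k);$$ that is, for $i>\rho$ the first block of $h_i$ is $O(t^{1/\rho})$ and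 its $\ell$th block is $O(t^{\min(\ell-1,\rho)/\rho})$ for $2\le\ell\le i$. -/

import Mathlib

open Matrix Filter Topology Asymptotics

namespace JordanPert

/-- The set `{1, …, k}` as a type; Jordan block sizes and positions inside a Jordan chain
are both counted from `1`. -/
abbrev Blk (k : ℕ) : Type := Finset.Icc 1 k

/-- The first element of `{1, …, i}`. -/
def first {k : ℕ} (i : Blk k) : Blk (i : ℕ) :=
  ⟨1, Finset.mem_Icc.2 ⟨le_rfl, (Finset.mem_Icc.1 i.2).1⟩⟩

/-- The last element of `{1, …, i}`. -/
def last {k : ℕ} (i : Blk k) : Blk (i : ℕ) :=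
  ⟨i, Finset.mem_Icc.2 ⟨(Finset.mem_Icc.1 i.2).1, le_rfl⟩⟩

/-- Columns belonging to the Jordan blocks of size `i`: `i` groups of `s i` columns each. -/
abbrev BIdx (s : ℕ → ℕ) (i : ℕ) : Type := Blk i × Fin (s i)

/-- All columns belonging to the eigenvalue `λ₀`, grouped by the Jordan block size. -/
abbrev JIdx (k : ℕ) (s : ℕ → ℕ) : Type := Σ i : Blk k, BIdx s (i : ℕ)

/-- One column (or row) group of size `s j` for every `j ∈ {i, i + 1, …, k}`. This type is
empty for `i = k + 1`. -/
abbrev Tail (k : ℕ) (s : ℕ → ℕ) (i : ℕ) : Type :=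
  Σ j : {j : Blk k // i ≤ (j : ℕ)}, Fin (s (j : Blk k))

/-- `N_i`: the `i × i` block matrix with identity blocks of order `s i` on the first block
superdiagonal, and zero blocks elsewhere. -/
def nilBlock (s : ℕ → ℕ) (i : ℕ) : Matrix (BIdx s i) (BIdx s i) ℂ :=
  Matrix.of fun p q => if (p.1 : ℕ) + 1 = (q.1 : ℕ) ∧ p.2 = q.2 then 1 else 0

/-- `N = diag (N_1, …, N_k)`. -/
def nil (k : ℕ) (s : ℕ → ℕ) : Matrix (JIdx k s) (JIdx k s) ℂ :=
  Matrix.blockDiagonal' fun i : Blk k => nilBlock s (i : ℕ)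

section Blocks

variable {n k : ℕ} {s : ℕ → ℕ}

/-- The block column `X_i` of `X = [X_1, …, X_k]`. -/
def colBlock (X : Matrix (Fin n) (JIdx k s) ℂ) (i : Blk k) :
    Matrix (Fin n) (BIdx s (i : ℕ)) ℂ :=
  X.submatrix id fun p => ⟨i, p⟩

/-- The block column `X_{iℓ}` of `X_i = [X_{i1}, …, X_{ii}]`. -/
def colSub (X : Matrix (Fin n) (JIdx k s) ℂ) (i : Blk k) (l : Blk (i : ℕ)) :
    Matrix (Fin n) (Fin (s i)) ℂ :=
  (colBlock X i).submatrix id fun a => (l, a)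

/-- `[X_{i1}, X_{i+1,1}, …, X_{k1}]`. -/
def tailFirst (X : Matrix (Fin n) (JIdx k s) ℂ) (i : ℕ) :
    Matrix (Fin n) (Tail k s i) ℂ :=
  Matrix.of fun r c => colSub X c.1.1 (first c.1.1) r c.2

/-- `[X_{ii}, X_{i+1,i+1}, …, X_{kk}]`. -/
def tailLast (X : Matrix (Fin n) (JIdx k s) ℂ) (i : ℕ) :
    Matrix (Fin n) (Tail k s i) ℂ :=
  Matrix.of fun r c => colSub X c.1.1 (last c.1.1) r c.2

/-- `W_i = [Σ_{ii}, …, Σ_{kk}]ᴴ D [Ξ_{i1}, …, Ξ_{k1}]`. -/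
def W (Xi Sg : Matrix (Fin n) (JIdx k s) ℂ) (D : Matrix (Fin n) (Fin n) ℂ) (i : ℕ) :
    Matrix (Tail k s i) (Tail k s i) ℂ :=
  (tailLast Sg i)ᴴ * D * tailFirst Xi i

/-- `G_ρ = - W_{ρ+1}⁻¹ Z_{ρ+1,ρ}`, where `Z_{ρ+1,ρ}` has the block rows
`Σ_{jj}ᴴ D Ξ_{ρ1}`, `j = ρ + 1, …, k`. -/
noncomputable def G (Xi Sg : Matrix (Fin n) (JIdx k s) ℂ) (D : Matrix (Fin n) (Fin n) ℂ)
    (ρ : Blk k) : Matrix (Tail k s (ρ + 1)) (Fin (s ρ)) ℂ :=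
  -((W Xi Sg D (ρ + 1))⁻¹ * ((tailLast Sg (ρ + 1))ᴴ * D * colSub Xi ρ (first ρ)))

/-- `S_ρ = Σ_{ρρ}ᴴ D Ξ_{ρ1} + W_{ρ,ρ+1} G_ρ`, where `W_{ρ,ρ+1}` has the block columns
`Σ_{ρρ}ᴴ D Ξ_{j1}`, `j = ρ + 1, …, k`. -/
noncomputable def S (Xi Sg : Matrix (Fin n) (JIdx k s) ℂ) (D : Matrix (Fin n) (Fin n) ℂ)
    (ρ : Blk k) : Matrix (Fin (s ρ)) (Fin (s ρ)) ℂ :=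
  (colSub Sg ρ (last ρ))ᴴ * D * colSub Xi ρ (first ρ) +
    ((colSub Sg ρ (last ρ))ᴴ * D * tailFirst Xi (ρ + 1)) * G Xi Sg D ρ

/-- The stacked vector `[φ; u]` with top block `φ` (block number `ρ`) and lower blocks `u`
(block numbers `ρ + 1, …, k`). -/
def stack (ρ : Blk k) (φ : Fin (s ρ) → ℂ) (u : Tail k s (ρ + 1) → ℂ) : Tail k s ρ → ℂ :=
  fun c =>
    if h : (c.1 : Blk k) = ρ then φ (Fin.cast (by rw [h]) c.2)
    else u ⟨⟨c.1, Nat.succ_le_of_lt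
      (lt_of_le_of_ne c.1.2 fun e => h (Subtype.ext e.symm))⟩, c.2⟩

/-- The exponent `e` in the fractional order `t ^ (e / ρ)` of the `l`-th block (`1 ≤ l ≤ i`) of
the remainder in `h_i`:
`(ρ - i, ρ - i + 1, …, ρ - 1)` for `i < ρ`,
`(1, 2, …, ρ)` for `i = ρ`, and
`(1, 1, 2, …, ρ - 1, ρ, …, ρ)` for `i > ρ`. -/
def order (ρ i l : ℕ) : ℕ :=
  if i < ρ then ρ - i + (l - 1)
  else if i = ρ then l
  else if l = 1 then 1
  else min (l - 1) ρ

/-- The explicit part of `h_ρ`: its first block is zero, and its `l`-th block is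
`w ^ (l - 1) • φ` for `2 ≤ l ≤ ρ`. -/
def lead (ρ : ℕ) (φ : Fin (s ρ) → ℂ) (w : ℂ) (l : Blk ρ) : Fin (s ρ) → ℂ :=
  if (l : ℕ) = 1 then 0 else w ^ ((l : ℕ) - 1) • φ

end Blocks

end JordanPert


/-! In the basis `[Ξ, Ξ_c]` the eigenvalue equation of `A + t D` reads
`(diag (N, C) + τ ^ ρ E) x = ν x` with `τ = t ^ (1 / ρ)`, `ν = λ - λ₀`, `C = A₂₂ - λ₀ I` and
`E = [Σ, Σ_c]ᴴ D [Ξ, Ξ_c]`. After scaling each coordinate by its expected order in `τ`, putting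
`ν = τ c` and cancelling powers of `τ` row by row, it becomes polynomial in `τ` with a generalized
eigenvalue problem in `c` at `τ = 0`. There the Jordan chains longer than `ρ` force the vector of
first coordinates to be `[φ; G_ρ φ]`, and the chains of length `ρ` then require
`S_ρ φ = c ^ ρ φ`. Hence a simple eigenvalue `μ ^ ρ ≠ 0` of `S_ρ` makes `μ` a simple eigenvalue of
the limit problem, which the implicit function theorem continues to small `τ`; undoing the scaling
gives the expansions. -/
namespace JordanPert

section Pencil

/-- `μ` is a simple eigenvalue of the linear pencil `B - μ C`, with eigenvector `y`: there is no
Jordan chain of length two above `y`, and the eigenspace is spanned by `y`. -/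
structure IsSimpleEigenpair {K X Y : Type*} [Field K] [AddCommGroup X] [Module K X]
    [AddCommGroup Y] [Module K Y] (B C : X →ₗ[K] Y) (μ : K) (y : X) : Prop where
  ne_zero : y ≠ 0
  map_eq : B y = μ • C y
  simple : ∀ (δ : K) (u : X), B u - μ • C u = δ • C y → δ = 0 ∧ ∃ α : K, u = α • y

theorem isSimpleEigenpair_of_rootMultiplicity_charpoly_eq_one {K X : Type*} [Field K]
    [AddCommGroup X] [Module K X] [FiniteDimensional K X] {f : Module.End K X} {μ : K}
    (hμ : f.charpoly.rootMultiplicity μ = 1) {v : X} (hv : f.HasEigenvector μ v) :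
    IsSimpleEigenpair f 1 μ v where
  ne_zero := hv.2
  map_eq := hv.apply_eq_smul
  simple := by
    intro δ u hu
    have hfinrank : Module.finrank K (f.maxGenEigenspace μ) = 1 := by
      rw [LinearMap.finrank_maxGenEigenspace_eq, hμ]
    have hv_mem : v ∈ f.maxGenEigenspace μ :=
      (f.mem_maxGenEigenspace μ v).2 ⟨1, by simp [hv.apply_eq_smul]⟩
    have hu_mem : u ∈ f.maxGenEigenspace μ := by
      refine (f.mem_maxGenEigenspace μ u).2 ⟨2, ?_⟩
      have hfu : (f - μ • (1 : Module.End K X)) u = δ • v := by simpa using hu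
      rw [pow_two, Module.End.mul_apply, hfu]
      simp [hv.apply_eq_smul]
    obtain ⟨α, hα⟩ := (finrank_eq_one_iff_of_nonzero' (⟨v, hv_mem⟩ : f.maxGenEigenspace μ)
      fun h => hv.2 (congrArg Subtype.val h)).1 hfinrank ⟨u, hu_mem⟩
    obtain rfl : α • v = u := congrArg Subtype.val hα
    refine ⟨?_, α, rfl⟩
    rw [map_smul, hv.apply_eq_smul, Module.End.one_apply, Module.End.one_apply, smul_comm,
      sub_self] at hu
    exact (smul_eq_zero.1 hu.symm).resolve_right hv.2

variable {𝕜 E X : Type*} [NontriviallyNormedField 𝕜] [NormedAddCommGroup E] [NormedSpace 𝕜 E]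
  [NormedAddCommGroup X] [NormedSpace 𝕜 X]

/-- The equations `(B - ν C) y = 0`, `ℓ y = const` as one map of the parameter `e` and of the
eigenpair `(ν, y)`; the implicit function theorem is applied to it. -/
def pencilResidual (B C : E → X →L[𝕜] X) (ℓ : X →L[𝕜] 𝕜) (z : E × 𝕜 × X) : X × 𝕜 :=
  (B z.1 z.2.2 - z.2.1 • C z.1 z.2.2, ℓ z.2.2)

theorem exists_hasStrictFDerivAt_pencilResidual {B C : E → X →L[𝕜] X} {e₀ : E}
    {B' C' : E →L[𝕜] X →L[𝕜] X} (hB : HasStrictFDerivAt B B' e₀)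
    (hC : HasStrictFDerivAt C C' e₀) (ℓ : X →L[𝕜] 𝕜) (μ : 𝕜) (y : X) :
    ∃ F' : E × 𝕜 × X →L[𝕜] X × 𝕜, HasStrictFDerivAt (pencilResidual B C ℓ) F' (e₀, μ, y) ∧
      ∀ δ u, F' (0, δ, u) = (B e₀ u - μ • C e₀ u - δ • C e₀ y, ℓ u) := by
  have hfst : HasStrictFDerivAt (Prod.fst : E × 𝕜 × X → E) (.fst 𝕜 E (𝕜 × X)) (e₀, μ, y) :=
    hasStrictFDerivAt_fst
  have hsnd : HasStrictFDerivAt (Prod.snd : E × 𝕜 × X → 𝕜 × X) (.snd 𝕜 E (𝕜 × X)) (e₀, μ, y) :=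
    hasStrictFDerivAt_snd
  have hν := hsnd.fst
  have hy := hsnd.snd
  refine ⟨_, ((((hB.comp _ hfst).clm_apply hy).sub
    (hν.smul ((hC.comp _ hfst).clm_apply hy))).prodMk (ℓ.hasStrictFDerivAt.comp _ hy)), ?_⟩
  intro δ u
  simp [sub_sub]

variable [CompleteSpace 𝕜] [CompleteSpace E] [FiniteDimensional 𝕜 X]

/-- Normalizing by a functional `ℓ` makes the eigenvector unique, which is what the implicit
function theorem needs. -/
theorem IsSimpleEigenpair.exists_branch {B C : E → X →L[𝕜] X} {e₀ : E}
    {B' C' : E →L[𝕜] X →L[𝕜] X} (hB : HasStrictFDerivAt B B' e₀)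
    (hC : HasStrictFDerivAt C C' e₀) {μ : 𝕜} {y₀ : X}
    (h : IsSimpleEigenpair (B e₀ : X →ₗ[𝕜] X) (C e₀ : X →ₗ[𝕜] X) μ y₀)
    (ℓ : X →L[𝕜] 𝕜) (hℓ : ℓ y₀ ≠ 0) :
    ∃ (ν : E → 𝕜) (y : E → X),
      ((fun e => ν e - μ) =O[𝓝 e₀] fun e => e - e₀) ∧
      ((fun e => y e - y₀) =O[𝓝 e₀] fun e => e - e₀) ∧
      ∀ᶠ e in 𝓝 e₀, B e (y e) = ν e • C e (y e) ∧ ℓ (y e) = ℓ y₀ := by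
  have : CompleteSpace X := FiniteDimensional.complete 𝕜 X
  obtain ⟨F', hF, hF'⟩ := exists_hasStrictFDerivAt_pencilResidual hB hC ℓ μ y₀
  have hinj : Function.Injective (F' ∘L .inr 𝕜 E (𝕜 × X)) := by
    rw [injective_iff_map_eq_zero]
    rintro ⟨δ, u⟩ hδu
    obtain ⟨hu, hℓu⟩ := Prod.mk_eq_zero.1 ((hF' δ u).symm.trans hδu)
    obtain ⟨rfl, α, rfl⟩ := h.simple δ u (sub_eq_zero.1 hu)
    have hα : α = 0 := by simpa [hℓ] using hℓu
    simp [hα]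
  have hinv : (F' ∘L .inr 𝕜 E (𝕜 × X)).IsInvertible :=
    ⟨(LinearEquiv.ofInjectiveOfFinrankEq (F' ∘L .inr 𝕜 E (𝕜 × X)).toLinearMap hinj
      (by simp [add_comm])).toContinuousLinearEquiv, rfl⟩
  set ψ := hF.implicitFunctionOfProdDomain hinv
  have hψ₀ : ψ e₀ = (μ, y₀) :=
    (hF.eventually_apply_eq_iff_implicitFunctionOfProdDomain hinv).self_of_nhds.mp rfl
  have hψ : (fun e => ψ e - (μ, y₀)) =O[𝓝 e₀] fun e => e - e₀ := by
    rw [← hψ₀]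
    exact (hF.hasStrictFDerivAt_implicitFunctionOfProdDomain hinv).hasFDerivAt.isBigO_sub
  refine ⟨fun e => (ψ e).1, fun e => (ψ e).2, isBigO_fst_prod.trans hψ, isBigO_snd_prod.trans hψ,
    ?_⟩
  filter_upwards [hF.eventually_apply_implicitFunctionOfProdDomain hinv] with e he
  have hres : pencilResidual B C ℓ (e₀, μ, y₀) = (0, ℓ y₀) :=
    Prod.ext (sub_eq_zero.2 h.map_eq) rfl
  rw [hres] at he
  exact ⟨sub_eq_zero.1 (congrArg Prod.fst he), congrArg Prod.snd he⟩

end Pencil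

section Scaling

variable {K V : Type*} [Field K] [Fintype V]

/-- There are as many rows in the range of `r` as there are prescribed coordinates, so that
solvability of the remaining rows follows from uniqueness. -/
theorem exists_mulVec_apply_eq_zero_and_comp_eq {ι : Type*} [Finite ι] {M : Matrix V V K}
    {r c : ι → V} (hr : Function.Injective r)
    (h : ∀ u : V → K, (∀ p ∉ Set.range r, (M *ᵥ u) p = 0) → u ∘ c = 0 → u = 0) (φ : ι → K) :
    ∃ y : V → K, (∀ p ∉ Set.range r, (M *ᵥ y) p = 0) ∧ y ∘ c = φ := by
  classical
  have := Fintype.ofFinite ι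
  let L : (V → K) →ₗ[K] ({p // p ∉ Set.range r} → K) × (ι → K) :=
    ((LinearMap.funLeft K K Subtype.val) ∘ₗ M.mulVecLin).prod (LinearMap.funLeft K K c)
  have hinj : Function.Injective L := by
    rw [injective_iff_map_eq_zero]
    intro u hu
    obtain ⟨hM, hc⟩ := Prod.mk_eq_zero.1 hu
    exact h u (fun p hp => congrFun hM ⟨p, hp⟩) hc
  have hrank : Module.finrank K (V → K) =
      Module.finrank K (({p // p ∉ Set.range r} → K) × (ι → K)) := by
    have hcard := Fintype.card_subtype_compl (fun p => p ∈ Set.range r)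
    have hle := Fintype.card_subtype_le (fun p => p ∈ Set.range r)
    have hcr : Fintype.card {p // p ∈ Set.range r} = Fintype.card ι :=
      (Fintype.card_congr (Equiv.ofInjective r hr)).symm
    simp only [Module.finrank_prod, Module.finrank_fintype_fun_eq_card]
    omega
  obtain ⟨y, hy⟩ := (LinearMap.injective_iff_surjective_of_finrank_eq_finrank hrank).1 hinj (0, φ)
  exact ⟨y, fun p hp => congrFun (congrArg Prod.fst hy) ⟨p, hp⟩, congrArg Prod.snd hy⟩

/-- The matrix `J + τ ^ ρ E` after the substitution `x q = τ ^ e q * y q`, with the row `p` of the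
eigenvalue equation divided by `τ ^ min (e p + 1) ρ`. The subtraction is truncated: the row `p`
sees the perturbation at `τ = 0` exactly if `ρ ≤ e p + 1`. -/
def scaledMatrix (J E : Matrix V V K) (ρ : ℕ) (e : V → ℕ) (τ : K) : Matrix V V K :=
  J + of fun p q => τ ^ (ρ - (e p + 1) + e q) * E p q

theorem scaledMatrix_mulVec (J E : Matrix V V K) (ρ : ℕ) (e : V → ℕ) (τ : K) (u : V → K) (p : V) :
    (scaledMatrix J E ρ e τ *ᵥ u) p =
      (J *ᵥ u) p + τ ^ (ρ - (e p + 1)) * (E *ᵥ fun q => τ ^ e q * u q) p := by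
  rw [scaledMatrix, add_mulVec, Pi.add_apply]
  congr 1
  simp only [mulVec, dotProduct, of_apply, pow_add, Finset.mul_sum]
  exact Finset.sum_congr rfl fun q _ => by ring

variable [DecidableEq V]

/-- The coefficient of the rescaled eigenvalue `ν / τ` in the same rescaled equation; the
subtraction is truncated. -/
def scaledWeight (ρ : ℕ) (e : V → ℕ) (τ : K) : Matrix V V K :=
  diagonal fun p => τ ^ (e p + 1 - ρ)

theorem add_pow_smul_mul_diagonal {J : Matrix V V K} {ρ : ℕ} {e : V → ℕ}
    (hJ : ∀ p q, J p q ≠ 0 → e q = min (e p + 1) ρ) (E : Matrix V V K) (τ : K) :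
    (J + τ ^ ρ • E) * diagonal (fun q => τ ^ e q) =
      diagonal (fun p => τ ^ min (e p + 1) ρ) * scaledMatrix J E ρ e τ := by
  ext p q
  have hJpq : J p q * τ ^ e q = τ ^ min (e p + 1) ρ * J p q := by
    by_cases h : J p q = 0
    · simp [h]
    · rw [hJ p q h, mul_comm]
  have hE : τ ^ ρ * τ ^ e q = τ ^ min (e p + 1) ρ * τ ^ (ρ - (e p + 1) + e q) := by
    rw [← pow_add, ← pow_add]
    congr 1
    omega
  simp only [mul_diagonal, diagonal_mul, scaledMatrix, Matrix.add_apply, Matrix.smul_apply,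
    of_apply, smul_eq_mul]
  linear_combination hJpq + E p q * hE

theorem smul_diagonal_eq_mul_scaledWeight (ρ : ℕ) (e : V → ℕ) (τ : K) :
    τ • diagonal (fun q => τ ^ e q) =
      diagonal (fun p => τ ^ min (e p + 1) ρ) * scaledWeight ρ e τ := by
  rw [scaledWeight, diagonal_mul_diagonal, ← diagonal_smul]
  congr 1
  ext p
  rw [Pi.smul_apply, smul_eq_mul, ← pow_succ', ← pow_add]
  congr 1
  omega

theorem mulVec_eq_smul_of_scaled {J : Matrix V V K} {ρ : ℕ} {e : V → ℕ}
    (hJ : ∀ p q, J p q ≠ 0 → e q = min (e p + 1) ρ) {E : Matrix V V K} {τ c : K} {y : V → K}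
    (h : scaledMatrix J E ρ e τ *ᵥ y = c • (scaledWeight ρ e τ *ᵥ y)) :
    (J + τ ^ ρ • E) *ᵥ (diagonal (fun q => τ ^ e q) *ᵥ y) =
      (τ * c) • (diagonal (fun q => τ ^ e q) *ᵥ y) := by
  rw [mulVec_mulVec, add_pow_smul_mul_diagonal hJ, ← mulVec_mulVec, h, mulVec_smul, mulVec_mulVec,
    ← smul_diagonal_eq_mul_scaledWeight, smul_mulVec, smul_smul, mul_comm]

theorem scaledWeight_mulVec (ρ : ℕ) (e : V → ℕ) (τ : K) (u : V → K) (p : V) :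
    (scaledWeight ρ e τ *ᵥ u) p = τ ^ (e p + 1 - ρ) * u p :=
  mulVec_diagonal _ _ _

end Scaling

section ScaledBranch

variable {𝕜 V : Type*} [RCLike 𝕜] [Fintype V]

theorem contDiff_toContinuousLinearMap_mulVecLin {M : 𝕜 → Matrix V V 𝕜}
    (hM : ∀ p q, ContDiff 𝕜 1 fun τ => M τ p q) :
    ContDiff 𝕜 1 fun τ => LinearMap.toContinuousLinearMap (M τ).mulVecLin := by
  refine contDiff_clm_apply_iff.2 fun u => contDiff_pi.2 fun p => ?_
  exact ContDiff.sum fun q _ => (hM p q).mul contDiff_const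

variable [DecidableEq V]

theorem exists_branch_of_scaled {J E : Matrix V V 𝕜} {ρ : ℕ} {e : V → ℕ}
    (hJ : ∀ p q, J p q ≠ 0 → e q = min (e p + 1) ρ) {μ : 𝕜} {y₀ : V → 𝕜}
    (h : IsSimpleEigenpair (scaledMatrix J E ρ e 0).mulVecLin (scaledWeight ρ e 0).mulVecLin μ y₀)
    {q₀ : V} (he : e q₀ = 0) (hy₀ : y₀ q₀ ≠ 0) :
    ∃ (c : 𝕜 → 𝕜) (y : 𝕜 → V → 𝕜),
      ((fun τ => c τ - μ) =O[𝓝 0] fun τ => τ) ∧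
      ((fun τ => y τ - y₀) =O[𝓝 0] fun τ => τ) ∧
      ∀ᶠ τ in 𝓝 0, (J + τ ^ ρ • E) *ᵥ (diagonal (fun q => τ ^ e q) *ᵥ y τ) =
        (τ * c τ) • (diagonal (fun q => τ ^ e q) *ᵥ y τ) ∧
        diagonal (fun q => τ ^ e q) *ᵥ y τ ≠ 0 := by
  have hB := contDiff_toContinuousLinearMap_mulVecLin (M := scaledMatrix J E ρ e) fun p q =>
    contDiff_const.add ((contDiff_id.pow _).mul contDiff_const)
  have hC := contDiff_toContinuousLinearMap_mulVecLin (M := scaledWeight (K := 𝕜) ρ e) fun p q => by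
    by_cases hpq : p = q
    · subst hpq
      simpa [scaledWeight] using contDiff_id.pow _
    · simpa [scaledWeight, hpq] using contDiff_const
  obtain ⟨c, y, hc, hy, heq⟩ := IsSimpleEigenpair.exists_branch
    (hB.contDiffAt.hasStrictFDerivAt one_ne_zero) (hC.contDiffAt.hasStrictFDerivAt one_ne_zero)
    h (.proj q₀) hy₀
  simp only [sub_zero] at hc hy
  refine ⟨c, y, hc, hy, ?_⟩
  filter_upwards [heq] with τ ⟨hτ, hq₀⟩
  refine ⟨mulVec_eq_smul_of_scaled hJ hτ, fun h0 => hy₀ ?_⟩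
  have hx := congrFun h0 q₀
  rw [mulVec_diagonal, he, pow_zero, one_mul] at hx
  exact hq₀.symm.trans hx

end ScaledBranch

section Indices

variable {k : ℕ} {s : ℕ → ℕ} {κ : Type*}

theorem blk_succ_induction {i : Blk k} {P : Blk (i : ℕ) → Prop} (hfirst : P (first i))
    (hsucc : ∀ l l' : Blk (i : ℕ), (l : ℕ) + 1 = l' → P l → P l') (l : Blk (i : ℕ)) : P l := by
  obtain ⟨l, hl⟩ := l
  induction l, (Finset.mem_Icc.1 hl).1 using Nat.le_induction with
  | base => exact hfirst
  | succ l h1 ih =>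
    have hl' : l ∈ Finset.Icc 1 (i : ℕ) :=
      Finset.mem_Icc.2 ⟨h1, (Nat.le_succ l).trans (Finset.mem_Icc.1 hl).2⟩
    exact hsucc ⟨l, hl'⟩ ⟨l + 1, hl⟩ rfl (ih hl')

theorem blk_pred_induction {i : Blk k} {P : Blk (i : ℕ) → Prop} (hlast : P (last i))
    (hpred : ∀ l l' : Blk (i : ℕ), (l : ℕ) + 1 = l' → P l' → P l) (l : Blk (i : ℕ)) : P l := by
  obtain ⟨l, hl⟩ := l
  induction (Finset.mem_Icc.1 hl).2 using Nat.decreasingInduction with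
  | self => exact hlast
  | of_succ l hli ih =>
    have hl' : l + 1 ∈ Finset.Icc 1 (i : ℕ) := Finset.mem_Icc.2 ⟨by omega, hli⟩
    exact hpred ⟨l, hl⟩ ⟨l + 1, hl'⟩ rfl (ih hl')

/-- The chains of length `ρ` among the chains of length at least `ρ`. -/
def tailHead (ρ : Blk k) (a : Fin (s ρ)) : Tail k s ρ := ⟨⟨ρ, le_rfl⟩, a⟩

/-- The chains of length more than `ρ` among the chains of length at least `ρ`. -/
def tailTail (ρ : Blk k) (c : Tail k s (ρ + 1)) : Tail k s ρ :=
  ⟨⟨c.1.1, (Nat.le_succ _).trans c.1.2⟩, c.2⟩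

theorem tailHead_injective (ρ : Blk k) : Function.Injective (tailHead (s := s) ρ) := by
  intro a a' h
  simpa [tailHead] using h

theorem tailTail_injective (ρ : Blk k) : Function.Injective (tailTail (s := s) ρ) := by
  rintro ⟨⟨j, hj⟩, a⟩ ⟨⟨j', hj'⟩, a'⟩ h
  simp only [tailTail, Sigma.mk.injEq, Subtype.mk.injEq] at h
  obtain ⟨rfl, h⟩ := h
  cases h
  rfl

theorem tailHead_ne_tailTail (ρ : Blk k) (a : Fin (s ρ)) (c : Tail k s (ρ + 1)) :
    tailHead ρ a ≠ tailTail ρ c := by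
  intro h
  have hρ : (ρ : ℕ) = (c.1.1 : ℕ) := congrArg (fun c : Tail k s ρ => (c.1.1 : ℕ)) h
  have := c.1.2
  omega

theorem tail_cases (ρ : Blk k) (c : Tail k s ρ) :
    (∃ a, c = tailHead ρ a) ∨ ∃ c', c = tailTail ρ c' := by
  obtain ⟨⟨j, hj⟩, a⟩ := c
  by_cases h : j = ρ
  · subst h
    exact Or.inl ⟨a, rfl⟩
  · exact Or.inr ⟨⟨⟨j, Nat.succ_le_of_lt (lt_of_le_of_ne hj fun e => h (Subtype.ext e.symm))⟩, a⟩,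
      rfl⟩

theorem sum_tail {M : Type*} [AddCommMonoid M] (ρ : Blk k) (f : Tail k s ρ → M) :
    ∑ c, f c = ∑ a, f (tailHead ρ a) + ∑ c, f (tailTail ρ c) := by
  have hbij : Function.Bijective (Sum.elim (tailHead (s := s) ρ) (tailTail ρ)) := by
    refine ⟨(tailHead_injective ρ).sumElim (tailTail_injective ρ)
      (tailHead_ne_tailTail ρ), fun c => ?_⟩
    rcases tail_cases ρ c with ⟨a, rfl⟩ | ⟨c', rfl⟩
    · exact ⟨Sum.inl a, rfl⟩
    · exact ⟨Sum.inr c', rfl⟩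
  rw [← hbij.sum_comp, Fintype.sum_sum_type]
  rfl

theorem stack_tailHead (ρ : Blk k) (x : Fin (s ρ) → ℂ) (y : Tail k s (ρ + 1) → ℂ) (a : Fin (s ρ)) :
    stack ρ x y (tailHead ρ a) = x a := by
  simp [stack, tailHead]

theorem stack_tailTail (ρ : Blk k) (x : Fin (s ρ) → ℂ) (y : Tail k s (ρ + 1) → ℂ)
    (c : Tail k s (ρ + 1)) : stack ρ x y (tailTail ρ c) = y c := by
  have h : (c.1.1 : Blk k) ≠ ρ := by
    intro h
    have := c.1.2
    rw [h] at this
    omega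
  simp [stack, tailTail, h]

theorem eq_stack_iff {ρ : Blk k} {v : Tail k s ρ → ℂ} {x : Fin (s ρ) → ℂ}
    {y : Tail k s (ρ + 1) → ℂ} :
    v = stack ρ x y ↔ v ∘ tailHead ρ = x ∧ v ∘ tailTail ρ = y := by
  constructor
  · rintro rfl
    exact ⟨funext (stack_tailHead ρ x y), funext (stack_tailTail ρ x y)⟩
  · rintro ⟨rfl, rfl⟩
    ext c
    rcases tail_cases ρ c with ⟨a, rfl⟩ | ⟨c', rfl⟩
    · rw [stack_tailHead, Function.comp_apply]
    · rw [stack_tailTail, Function.comp_apply]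

theorem stack_zero_zero (ρ : Blk k) : stack (s := s) ρ 0 0 = 0 :=
  ((eq_stack_iff (v := 0)).2 ⟨rfl, rfl⟩).symm

/-- The index of the first vector of the Jordan chain `c`, among all columns of `[Ξ, Ξ_c]`. -/
def firstIdx (i : ℕ) (c : Tail k s i) : JIdx k s ⊕ κ := Sum.inl ⟨c.1.1, (first c.1.1, c.2)⟩

/-- The index of the last vector of the Jordan chain `c`, among all columns of `[Ξ, Ξ_c]`. -/
def lastIdx (i : ℕ) (c : Tail k s i) : JIdx k s ⊕ κ := Sum.inl ⟨c.1.1, (last c.1.1, c.2)⟩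

theorem firstIdx_injective (i : ℕ) :
    Function.Injective (firstIdx i : Tail k s i → JIdx k s ⊕ κ) := by
  rintro ⟨⟨j, hj⟩, a⟩ ⟨⟨j', hj'⟩, a'⟩ h
  simp only [firstIdx, Sum.inl.injEq, Sigma.mk.injEq] at h
  obtain ⟨rfl, h⟩ := h
  simpa using h

theorem lastIdx_injective (i : ℕ) :
    Function.Injective (lastIdx i : Tail k s i → JIdx k s ⊕ κ) := by
  rintro ⟨⟨j, hj⟩, a⟩ ⟨⟨j', hj'⟩, a'⟩ h
  simp only [lastIdx, Sum.inl.injEq, Sigma.mk.injEq] at h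
  obtain ⟨rfl, h⟩ := h
  simpa using h

theorem lastIdx_tailTail_notMem_range (ρ : Blk k) (c : Tail k s (ρ + 1)) :
    (lastIdx ρ (tailTail ρ c) : JIdx k s ⊕ κ) ∉ Set.range (lastIdx ρ ∘ tailHead ρ) := by
  rintro ⟨a, ha⟩
  exact tailHead_ne_tailTail ρ a c (lastIdx_injective _ ha)

theorem inl_notMem_range_of_succ {ρ i : Blk k} {l l' : Blk (i : ℕ)} (h : (l : ℕ) + 1 = l')
    (a : Fin (s i)) :
    (Sum.inl ⟨i, (l, a)⟩ : JIdx k s ⊕ κ) ∉ Set.range (lastIdx ρ ∘ tailHead ρ) := by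
  rintro ⟨a', h'⟩
  cases h'
  have hl' : (l' : ℕ) ≤ ρ := (Finset.mem_Icc.1 l'.2).2
  have hρ : (ρ : ℕ) + 1 = l' := h
  omega

/-- The order in `τ = t ^ (1 / ρ)` of a coordinate of the perturbed eigenvector in the basis
`[Ξ, Ξ_c]`. -/
def coordOrder (ρ : ℕ) : JIdx k s ⊕ κ → ℕ
  | Sum.inl ⟨i, (l, _)⟩ => if (i : ℕ) < ρ then ρ - i + (l - 1) else min (l - 1) ρ
  | Sum.inr _ => ρ

theorem coordOrder_of_lt {ρ : ℕ} {i : Blk k} (h : (i : ℕ) < ρ) (p : BIdx s i) :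
    coordOrder (κ := κ) ρ (Sum.inl ⟨i, p⟩) = ρ - i + ((p.1 : ℕ) - 1) :=
  if_pos h

theorem coordOrder_of_le {ρ : ℕ} {i : Blk k} (h : ρ ≤ (i : ℕ)) (p : BIdx s i) :
    coordOrder (κ := κ) ρ (Sum.inl ⟨i, p⟩) = min ((p.1 : ℕ) - 1) ρ :=
  if_neg h.not_gt

theorem coordOrder_inr (ρ : ℕ) (j : κ) : coordOrder (k := k) (s := s) ρ (Sum.inr j) = ρ := rfl

theorem coordOrder_self (ρ : Blk k) (p : BIdx s ρ) :
    coordOrder (κ := κ) ρ (Sum.inl ⟨ρ, p⟩) = (p.1 : ℕ) - 1 := by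
  have := Finset.mem_Icc.1 p.1.2
  rw [coordOrder_of_le le_rfl]
  omega

theorem coordOrder_firstIdx (ρ : ℕ) (c : Tail k s ρ) :
    coordOrder (κ := κ) ρ (firstIdx ρ c) = 0 := by
  rw [firstIdx, coordOrder_of_le c.1.2]
  simp [first]

theorem coordOrder_lastIdx (ρ : ℕ) (c : Tail k s ρ) :
    coordOrder (κ := κ) ρ (lastIdx ρ c) = min ((c.1.1 : ℕ) - 1) ρ :=
  coordOrder_of_le c.1.2 _

theorem coordOrder_eq_zero_iff {ρ : ℕ} (hρ : ρ ≠ 0) {q : JIdx k s ⊕ κ} :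
    coordOrder ρ q = 0 ↔ q ∈ Set.range (firstIdx ρ) := by
  constructor
  · intro h
    rcases q with ⟨i, l, a⟩ | j
    · have hl := Finset.mem_Icc.1 l.2
      rcases lt_or_ge (i : ℕ) ρ with hi | hi
      · rw [coordOrder_of_lt hi] at h
        omega
      · rw [coordOrder_of_le hi] at h
        obtain rfl : l = first i := Subtype.ext (by dsimp only [first] at h ⊢; omega)
        exact ⟨⟨⟨i, hi⟩, a⟩, rfl⟩
    · exact absurd h hρ
  · rintro ⟨c, rfl⟩
    exact coordOrder_firstIdx ρ c

end Indices

section NilSum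

variable {k : ℕ} {s : ℕ → ℕ} {κ : Type*} (C : Matrix κ κ ℂ)

theorem nil_apply_of_ne {i j : Blk k} (h : i ≠ j) (p : BIdx s i) (q : BIdx s j) :
    nil k s ⟨i, p⟩ ⟨j, q⟩ = 0 :=
  blockDiagonal'_apply_ne _ _ _ h

theorem nil_apply_self (i : Blk k) (p q : BIdx s i) :
    nil k s ⟨i, p⟩ ⟨i, q⟩ = if (p.1 : ℕ) + 1 = q.1 ∧ p.2 = q.2 then 1 else 0 :=
  blockDiagonal'_apply_eq _ _ _ _

/-- The matrix `diag (N, C)`; for `C = A₂₂ - λ₀ I` it is `A - λ₀ I` in the basis `[Ξ, Ξ_c]`. -/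
def nilSum (s : ℕ → ℕ) (C : Matrix κ κ ℂ) : Matrix (JIdx k s ⊕ κ) (JIdx k s ⊕ κ) ℂ :=
  fromBlocks (nil k s) 0 0 C

theorem coordOrder_eq_of_nilSum_ne_zero (ρ : ℕ) (p q : JIdx k s ⊕ κ)
    (h : nilSum s C p q ≠ 0) : coordOrder ρ q = min (coordOrder ρ p + 1) ρ := by
  rcases p with ⟨i, p⟩ | p <;> rcases q with ⟨j, q⟩ | q
  · obtain rfl : i = j := by
      by_contra hij
      exact h (nil_apply_of_ne hij p q)
    obtain ⟨hpq, -⟩ : (p.1 : ℕ) + 1 = q.1 ∧ p.2 = q.2 := by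
      by_contra hpq
      exact h ((nil_apply_self i p q).trans (if_neg hpq))
    have hp := Finset.mem_Icc.1 p.1.2
    have hq := Finset.mem_Icc.1 q.1.2
    rcases lt_or_ge (i : ℕ) ρ with hi | hi
    · rw [coordOrder_of_lt hi, coordOrder_of_lt hi]
      omega
    · rw [coordOrder_of_le hi, coordOrder_of_le hi]
      omega
  · exact absurd rfl h
  · exact absurd rfl h
  · simp [coordOrder_inr]

variable [Fintype κ] (u : JIdx k s ⊕ κ → ℂ)

theorem nilSum_mulVec_inl (p : JIdx k s) :
    (nilSum s C *ᵥ u) (Sum.inl p) = (nil k s *ᵥ (u ∘ Sum.inl)) p := by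
  rw [nilSum, fromBlocks_mulVec]
  simp

theorem nilSum_mulVec_inr (j : κ) :
    (nilSum s C *ᵥ u) (Sum.inr j) = (C *ᵥ (u ∘ Sum.inr)) j := by
  rw [nilSum, fromBlocks_mulVec]
  simp

theorem nilSum_mulVec_of_succ {i : Blk k} {l l' : Blk (i : ℕ)} (h : (l : ℕ) + 1 = l')
    (a : Fin (s i)) :
    (nilSum s C *ᵥ u) (Sum.inl ⟨i, (l, a)⟩) = u (Sum.inl ⟨i, (l', a)⟩) := by
  rw [nilSum_mulVec_inl, mulVec, dotProduct, Fintype.sum_eq_single ⟨i, (l', a)⟩]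
  · simp [nil_apply_self, h]
  · rintro ⟨j, l'', a'⟩ hne
    rcases eq_or_ne i j with rfl | hij
    · rw [nil_apply_self, if_neg, zero_mul]
      rintro ⟨hl, rfl⟩
      obtain rfl : l'' = l' := Subtype.ext (hl.symm.trans h)
      exact hne rfl
    · rw [nil_apply_of_ne hij, zero_mul]

theorem nilSum_mulVec_lastIdx (i : ℕ) (c : Tail k s i) :
    (nilSum s C *ᵥ u) (lastIdx i c) = 0 := by
  rw [lastIdx, nilSum_mulVec_inl]
  refine Finset.sum_eq_zero ?_
  rintro ⟨j, l, a⟩ -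
  change nil k s ⟨c.1.1, (last c.1.1, c.2)⟩ ⟨j, (l, a)⟩ * _ = 0
  rcases eq_or_ne c.1.1 j with rfl | hij
  · rw [nil_apply_self, if_neg, zero_mul]
    rintro ⟨hl, -⟩
    have := Finset.mem_Icc.1 l.2
    simp only [last] at hl
    omega
  · rw [nil_apply_of_ne hij, zero_mul]

end NilSum

section Schur

variable {n k : ℕ} {s : ℕ → ℕ} {Xi Sg : Matrix (Fin n) (JIdx k s) ℂ}
  {D : Matrix (Fin n) (Fin n) ℂ} {ρ : Blk k}

theorem isUnit_W_succ (h : (ρ : ℕ) < k → IsUnit (W Xi Sg D (ρ + 1))) :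
    IsUnit (W Xi Sg D (ρ + 1)) := by
  by_cases hρ : (ρ : ℕ) < k
  · exact h hρ
  · have : IsEmpty (Tail k s (ρ + 1)) := ⟨fun c => by
      have := Finset.mem_Icc.1 c.1.1.2
      have := c.1.2
      omega⟩
    exact isUnit_of_subsingleton _

theorem W_mulVec_stack (x : Fin (s ρ) → ℂ) (y : Tail k s (ρ + 1) → ℂ) :
    W Xi Sg D ρ *ᵥ stack ρ x y =
      stack ρ
        (((colSub Sg ρ (last ρ))ᴴ * D * colSub Xi ρ (first ρ)) *ᵥ x +
          ((colSub Sg ρ (last ρ))ᴴ * D * tailFirst Xi (ρ + 1)) *ᵥ y)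
        (((tailLast Sg (ρ + 1))ᴴ * D * colSub Xi ρ (first ρ)) *ᵥ x + W Xi Sg D (ρ + 1) *ᵥ y) := by
  refine eq_stack_iff.2 ⟨?_, ?_⟩ <;> ext c <;>
    simp only [Function.comp_apply, mulVec, dotProduct, sum_tail, stack_tailHead,
      stack_tailTail] <;>
    rfl

theorem W_mulVec_stack_eq_stack_zero_iff (hW : IsUnit (W Xi Sg D (ρ + 1)))
    {x z : Fin (s ρ) → ℂ} {y : Tail k s (ρ + 1) → ℂ} :
    W Xi Sg D ρ *ᵥ stack ρ x y = stack ρ z 0 ↔ y = G Xi Sg D ρ *ᵥ x ∧ S Xi Sg D ρ *ᵥ x = z := by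
  have hWG : W Xi Sg D (ρ + 1) *ᵥ (G Xi Sg D ρ *ᵥ x) =
      -(((tailLast Sg (ρ + 1))ᴴ * D * colSub Xi ρ (first ρ)) *ᵥ x) := by
    rw [G, mulVec_mulVec, Matrix.mul_neg, neg_mulVec, ← Matrix.mul_assoc,
      Matrix.mul_nonsing_inv _ ((Matrix.isUnit_iff_isUnit_det _).1 hW), Matrix.one_mul]
  have htail : ((tailLast Sg (ρ + 1))ᴴ * D * colSub Xi ρ (first ρ)) *ᵥ x +
      W Xi Sg D (ρ + 1) *ᵥ y = 0 ↔ y = G Xi Sg D ρ *ᵥ x := by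
    rw [add_eq_zero_iff_eq_neg', ← hWG, (Matrix.mulVec_injective_of_isUnit hW).eq_iff]
  rw [W_mulVec_stack, eq_stack_iff, (eq_stack_iff.1 rfl).1, (eq_stack_iff.1 rfl).2, htail, and_comm,
    and_congr_right_iff]
  rintro rfl
  rw [S, add_mulVec, mulVec_mulVec]

theorem S_eigenvalue_ne_zero (hW : IsUnit (W Xi Sg D ρ)) (hW' : IsUnit (W Xi Sg D (ρ + 1)))
    {γ : ℂ} {φ : Fin (s ρ) → ℂ} (hφ0 : φ ≠ 0) (hφ : S Xi Sg D ρ *ᵥ φ = γ • φ) : γ ≠ 0 := by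
  rintro rfl
  rw [zero_smul] at hφ
  have hstack : stack ρ φ (G Xi Sg D ρ *ᵥ φ) = 0 := by
    apply Matrix.mulVec_injective_of_isUnit hW
    rw [mulVec_zero, ← stack_zero_zero ρ]
    exact (W_mulVec_stack_eq_stack_zero_iff hW').2 ⟨rfl, hφ⟩
  exact hφ0 (eq_stack_iff.1 hstack.symm).1.symm

end Schur

section Limit

variable {n k : ℕ} {s : ℕ → ℕ} {κ : Type*}

/-- The matrix of the rescaled eigenvalue equation at `t = 0`. -/
noncomputable def limitMatrix (ρ : ℕ) (C : Matrix κ κ ℂ)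
    (E : Matrix (JIdx k s ⊕ κ) (JIdx k s ⊕ κ) ℂ) : Matrix (JIdx k s ⊕ κ) (JIdx k s ⊕ κ) ℂ :=
  scaledMatrix (nilSum s C) E ρ (coordOrder ρ) 0

/-- The coefficient of the eigenvalue in the rescaled eigenvalue equation at `t = 0`. -/
noncomputable def limitWeight [DecidableEq κ] (ρ : ℕ) : Matrix (JIdx k s ⊕ κ) (JIdx k s ⊕ κ) ℂ :=
  scaledWeight ρ (coordOrder ρ) 0

variable [Fintype κ] {ρ : Blk k} {Xi Sg : Matrix (Fin n) (JIdx k s) ℂ}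
  {D : Matrix (Fin n) (Fin n) ℂ} {C : Matrix κ κ ℂ}
  {E : Matrix (JIdx k s ⊕ κ) (JIdx k s ⊕ κ) ℂ} {u w : JIdx k s ⊕ κ → ℂ}

theorem limitMatrix_mulVec (p : JIdx k s ⊕ κ) :
    (limitMatrix ρ C E *ᵥ u) p = (nilSum s C *ᵥ u) p +
      (0 : ℂ) ^ (ρ - (coordOrder ρ p + 1)) *
        (E.submatrix id (firstIdx ρ) *ᵥ (u ∘ firstIdx ρ)) p := by
  have hρ : (ρ : ℕ) ≠ 0 := Nat.one_le_iff_ne_zero.1 (Finset.mem_Icc.1 ρ.2).1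
  rw [limitMatrix, scaledMatrix_mulVec]
  congr 2
  refine (Fintype.sum_of_injective _ (firstIdx_injective ρ) _ _ (fun q hq => ?_) fun c => ?_).symm
  · change E p q * (0 ^ coordOrder ρ q * u q) = 0
    rw [zero_pow (mt (coordOrder_eq_zero_iff hρ).1 hq), zero_mul, mul_zero]
  · change E p (firstIdx ρ c) * u (firstIdx ρ c) =
      E p (firstIdx ρ c) * (0 ^ coordOrder ρ (firstIdx ρ c) * u (firstIdx ρ c))
    rw [coordOrder_firstIdx, pow_zero, one_mul]

theorem limitMatrix_mulVec_of_coordOrder_lt {p : JIdx k s ⊕ κ} (hp : coordOrder ρ p + 1 < ρ) :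
    (limitMatrix ρ C E *ᵥ u) p = (nilSum s C *ᵥ u) p := by
  rw [limitMatrix_mulVec, zero_pow (by omega), zero_mul, add_zero]

theorem limitMatrix_mulVec_lastIdx (c : Tail k s ρ) :
    (limitMatrix ρ C E *ᵥ u) (lastIdx ρ c) =
      (E.submatrix (lastIdx ρ) (firstIdx ρ) *ᵥ (u ∘ firstIdx ρ)) c := by
  have hc := c.1.2
  rw [limitMatrix_mulVec, nilSum_mulVec_lastIdx, zero_add, coordOrder_lastIdx,
    show (ρ : ℕ) - (min ((c.1.1 : ℕ) - 1) ρ + 1) = 0 by omega, pow_zero, one_mul]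
  rfl

theorem limitMatrix_mulVec_self_of_succ {l l' : Blk (ρ : ℕ)} (h : (l : ℕ) + 1 = l')
    (a : Fin (s ρ)) :
    (limitMatrix ρ C E *ᵥ u) (Sum.inl ⟨ρ, (l, a)⟩) = u (Sum.inl ⟨ρ, (l', a)⟩) := by
  have hl := Finset.mem_Icc.1 l.2
  have hl' := Finset.mem_Icc.1 l'.2
  rw [limitMatrix_mulVec_of_coordOrder_lt, nilSum_mulVec_of_succ C u h]
  rw [coordOrder_self]
  dsimp only
  omega

theorem limitMatrix_mulVec_of_comp_firstIdx_eq_zero (h : u ∘ firstIdx (ρ : ℕ) = 0) :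
    limitMatrix ρ C E *ᵥ u = nilSum s C *ᵥ u := by
  ext p
  rw [limitMatrix_mulVec, h, mulVec_zero, Pi.zero_apply, mul_zero, add_zero]

theorem schur_of_limitMatrix_mulVec (hW : IsUnit (W Xi Sg D (ρ + 1)))
    (hE : E.submatrix (lastIdx ρ) (firstIdx ρ) = W Xi Sg D ρ)
    (h : ∀ c, (limitMatrix ρ C E *ᵥ u) (lastIdx ρ (tailTail ρ c)) = 0) :
    (u ∘ firstIdx ρ) ∘ tailTail ρ = G Xi Sg D ρ *ᵥ ((u ∘ firstIdx ρ) ∘ tailHead ρ) ∧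
      S Xi Sg D ρ *ᵥ ((u ∘ firstIdx ρ) ∘ tailHead ρ) =
        fun a => (limitMatrix ρ C E *ᵥ u) (lastIdx ρ (tailHead ρ a)) := by
  rw [← W_mulVec_stack_eq_stack_zero_iff hW, ← eq_stack_iff.2 ⟨rfl, rfl⟩, ← hE]
  refine eq_stack_iff.2 ⟨?_, ?_⟩ <;> ext c
  · exact (limitMatrix_mulVec_lastIdx _).symm
  · exact (limitMatrix_mulVec_lastIdx _).symm.trans (h c)

variable [DecidableEq κ]

theorem limitWeight_mulVec (p : JIdx k s ⊕ κ) :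
    (limitWeight ρ *ᵥ u) p = (0 : ℂ) ^ (coordOrder ρ p + 1 - ρ) * u p :=
  scaledWeight_mulVec _ _ _ _ _

theorem limitWeight_mulVec_of_coordOrder_lt {p : JIdx k s ⊕ κ} (hp : coordOrder ρ p < ρ) :
    (limitWeight ρ *ᵥ u) p = u p := by
  rw [limitWeight_mulVec, Nat.sub_eq_zero_of_le hp, pow_zero, one_mul]

theorem limitWeight_mulVec_self (p : BIdx s ρ) :
    (limitWeight ρ *ᵥ u) (Sum.inl ⟨ρ, p⟩) = u (Sum.inl ⟨ρ, p⟩) := by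
  have hp := Finset.mem_Icc.1 p.1.2
  refine limitWeight_mulVec_of_coordOrder_lt ?_
  rw [coordOrder_self]
  omega

theorem limitWeight_mulVec_lastIdx_tailTail (c : Tail k s (ρ + 1)) :
    (limitWeight ρ *ᵥ u) (lastIdx ρ (tailTail ρ c)) = 0 := by
  have hc := c.1.2
  rw [limitWeight_mulVec, coordOrder_lastIdx, zero_pow, zero_mul]
  dsimp only [tailTail]
  omega

theorem eq_zero_of_limit_rows_of_le {μ : ℂ} (hfirst : u ∘ firstIdx (ρ : ℕ) = 0)
    (hrow : ∀ p ∉ Set.range (lastIdx ρ ∘ tailHead ρ),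
      (nilSum s C *ᵥ u) p = μ * (limitWeight ρ *ᵥ u) p)
    {i : Blk k} (hi : (ρ : ℕ) ≤ i) (l : Blk (i : ℕ)) (a : Fin (s i)) :
    u (Sum.inl ⟨i, (l, a)⟩) = 0 := by
  induction l using blk_succ_induction with
  | hfirst => exact congrFun hfirst ⟨⟨i, hi⟩, a⟩
  | hsucc l l' h ih =>
    rw [← nilSum_mulVec_of_succ C u h, hrow _ (inl_notMem_range_of_succ h a), limitWeight_mulVec,
      ih, mul_zero, mul_zero]

theorem eq_zero_of_limit_rows_of_lt {μ : ℂ} (hμ : μ ≠ 0)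
    (hrow : ∀ p ∉ Set.range (lastIdx ρ ∘ tailHead ρ),
      (nilSum s C *ᵥ u) p = μ * (limitWeight ρ *ᵥ u) p)
    {i : Blk k} (hi : (i : ℕ) < ρ) (l : Blk (i : ℕ)) (a : Fin (s i)) :
    u (Sum.inl ⟨i, (l, a)⟩) = 0 := by
  have hrow_block (l : Blk (i : ℕ)) :
      (nilSum s C *ᵥ u) (Sum.inl ⟨i, (l, a)⟩) = μ * u (Sum.inl ⟨i, (l, a)⟩) := by
    have hl := Finset.mem_Icc.1 l.2
    rw [hrow, limitWeight_mulVec_of_coordOrder_lt]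
    · rw [coordOrder_of_lt hi]
      dsimp only
      omega
    · rintro ⟨a', h'⟩
      cases h'
      exact hi.ne rfl
  induction l using blk_pred_induction with
  | hlast =>
    have hlast := nilSum_mulVec_lastIdx C u i ⟨⟨i, le_rfl⟩, a⟩
    exact (mul_eq_zero.1 ((hrow_block _).symm.trans hlast)).resolve_left hμ
  | hpred l l' h ih =>
    have hl := hrow_block l
    rw [nilSum_mulVec_of_succ C u h, ih] at hl
    exact (mul_eq_zero.1 hl.symm).resolve_left hμ

theorem eq_zero_of_limit_rows (hW : IsUnit (W Xi Sg D (ρ + 1)))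
    (hE : E.submatrix (lastIdx ρ) (firstIdx ρ) = W Xi Sg D ρ) (hC : IsUnit C)
    {μ : ℂ} (hμ : μ ≠ 0)
    (hrow : ∀ p ∉ Set.range (lastIdx ρ ∘ tailHead ρ),
      (limitMatrix ρ C E *ᵥ u) p = μ * (limitWeight ρ *ᵥ u) p)
    (hhead : u ∘ firstIdx ρ ∘ tailHead ρ = 0) : u = 0 := by
  have htail : (u ∘ firstIdx ρ) ∘ tailTail ρ = 0 := by
    refine (schur_of_limitMatrix_mulVec hW hE (C := C) fun c => ?_).1.trans ?_
    swap
    · rw [Function.comp_assoc, hhead, mulVec_zero]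
    rw [hrow _ (lastIdx_tailTail_notMem_range ρ c), limitWeight_mulVec_lastIdx_tailTail, mul_zero]
  have hfirst : u ∘ firstIdx (ρ : ℕ) = 0 := by
    rw [← stack_zero_zero ρ]
    exact eq_stack_iff.2 ⟨hhead, htail⟩
  rw [limitMatrix_mulVec_of_comp_firstIdx_eq_zero hfirst] at hrow
  have hinr : u ∘ Sum.inr = 0 := by
    apply Matrix.mulVec_injective_of_isUnit hC
    ext j
    rw [← nilSum_mulVec_inr, hrow _ (by rintro ⟨a, ⟨⟩⟩), limitWeight_mulVec, coordOrder_inr,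
      Nat.add_sub_cancel_left, pow_one, zero_mul, mul_zero, mulVec_zero, Pi.zero_apply]
  ext (⟨i, l, a⟩ | j)
  · rcases lt_or_ge (i : ℕ) ρ with hi | hi
    · exact eq_zero_of_limit_rows_of_lt hμ hrow hi l a
    · exact eq_zero_of_limit_rows_of_le hfirst hrow hi l a
  · exact congrFun hinr j

theorem mul_chain_eq {μ δ : ℂ} {x φ : Fin (s ρ) → ℂ} {v : Blk (ρ : ℕ) → Fin (s ρ) → ℂ}
    (hfirst : v (first ρ) = x)
    (hsucc : ∀ l l' : Blk (ρ : ℕ), (l : ℕ) + 1 = l' →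
      v l' = μ • v l + (δ * μ ^ ((l : ℕ) - 1)) • φ) (l : Blk (ρ : ℕ)) :
    μ • v l = μ ^ (l : ℕ) • x + ((((l : ℕ) : ℂ) - 1) * δ * μ ^ ((l : ℕ) - 1)) • φ := by
  induction l using blk_succ_induction with
  | hfirst => rw [hfirst]; simp [first]
  | hsucc l l' h ih =>
    have hl := Finset.mem_Icc.1 l.2
    obtain ⟨d, hd⟩ : ∃ d, (l : ℕ) = d + 1 := ⟨l - 1, by omega⟩
    rw [hsucc l l' h, ih, ← h, hd]
    simp only [Nat.add_sub_cancel, Nat.cast_add, Nat.cast_one]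
    module

theorem exists_limit_eigenvector (hW : IsUnit (W Xi Sg D (ρ + 1)))
    (hE : E.submatrix (lastIdx ρ) (firstIdx ρ) = W Xi Sg D ρ) (hC : IsUnit C)
    {μ : ℂ} (hμ : μ ≠ 0) {φ : Fin (s ρ) → ℂ} (hφ : S Xi Sg D ρ *ᵥ φ = μ ^ (ρ : ℕ) • φ) :
    ∃ y : JIdx k s ⊕ κ → ℂ, limitMatrix ρ C E *ᵥ y = μ • (limitWeight ρ *ᵥ y) ∧
      y ∘ firstIdx (ρ : ℕ) = stack ρ φ (G Xi Sg D ρ *ᵥ φ) ∧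
      ∀ (l : Blk (ρ : ℕ)) a, y (Sum.inl ⟨ρ, (l, a)⟩) = μ ^ ((l : ℕ) - 1) * φ a := by
  have happly (v : JIdx k s ⊕ κ → ℂ) (p : JIdx k s ⊕ κ) :
      ((limitMatrix ρ C E - μ • limitWeight ρ) *ᵥ v) p = 0 ↔
        (limitMatrix ρ C E *ᵥ v) p = μ * (limitWeight ρ *ᵥ v) p := by
    rw [sub_mulVec, smul_mulVec, Pi.sub_apply, Pi.smul_apply, smul_eq_mul, sub_eq_zero]
  obtain ⟨y, hrow, hhead⟩ := exists_mulVec_apply_eq_zero_and_comp_eq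
    (M := limitMatrix ρ C E - μ • limitWeight ρ) (r := lastIdx ρ ∘ tailHead ρ)
    (c := firstIdx ρ ∘ tailHead ρ) ((lastIdx_injective _).comp (tailHead_injective ρ))
    (fun v hv => eq_zero_of_limit_rows hW hE hC hμ fun p hp => (happly v p).1 (hv p hp)) φ
  replace hrow p hp := (happly y p).1 (hrow p hp)
  obtain ⟨htail, hlast⟩ := schur_of_limitMatrix_mulVec hW hE (C := C) (u := y) fun c => by
    rw [hrow _ (lastIdx_tailTail_notMem_range ρ c), limitWeight_mulVec_lastIdx_tailTail, mul_zero]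
  replace hhead : (y ∘ firstIdx (ρ : ℕ)) ∘ tailHead ρ = φ := hhead
  rw [hhead] at htail hlast
  have hchain (l : Blk (ρ : ℕ)) (a) : y (Sum.inl ⟨ρ, (l, a)⟩) = μ ^ ((l : ℕ) - 1) * φ a := by
    induction l using blk_succ_induction with
    | hfirst => exact (congrFun hhead a).trans (by simp [first])
    | hsucc l l' h ih =>
      have hl := Finset.mem_Icc.1 l.2
      rw [← limitMatrix_mulVec_self_of_succ (C := C) (E := E) (u := y) h,
        hrow _ (inl_notMem_range_of_succ h a), limitWeight_mulVec_self, ih, ← h, ← mul_assoc,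
        ← pow_succ', Nat.sub_add_comm hl.1]
  refine ⟨y, ?_, eq_stack_iff.2 ⟨hhead, htail⟩, hchain⟩
  ext p
  by_cases hp : p ∈ Set.range (lastIdx ρ ∘ tailHead ρ)
  · obtain ⟨a, rfl⟩ := hp
    refine (congrFun (hlast.symm.trans hφ) a).trans ?_
    change μ ^ (ρ : ℕ) * φ a = μ * (limitWeight ρ *ᵥ y) (Sum.inl ⟨ρ, (last ρ, a)⟩)
    rw [limitWeight_mulVec_self, hchain, ← mul_assoc, ← pow_succ']
    exact congrArg (μ ^ · * φ a) (Nat.sub_add_cancel (Finset.mem_Icc.1 ρ.2).1).symm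
  · exact hrow p hp

theorem schur_eq_of_limit_eq (hW : IsUnit (W Xi Sg D (ρ + 1)))
    (hE : E.submatrix (lastIdx ρ) (firstIdx ρ) = W Xi Sg D ρ) {μ δ : ℂ} {φ : Fin (s ρ) → ℂ}
    (hw : ∀ (l : Blk (ρ : ℕ)) a, w (Sum.inl ⟨ρ, (l, a)⟩) = μ ^ ((l : ℕ) - 1) * φ a)
    (hu : limitMatrix ρ C E *ᵥ u - μ • (limitWeight ρ *ᵥ u) = δ • (limitWeight ρ *ᵥ w)) :
    S Xi Sg D ρ *ᵥ (u ∘ firstIdx ρ ∘ tailHead ρ) =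
      μ ^ (ρ : ℕ) • (u ∘ firstIdx ρ ∘ tailHead ρ) + (ρ * δ * μ ^ ((ρ : ℕ) - 1)) • φ := by
  have hrow (p) : (limitMatrix ρ C E *ᵥ u) p =
      μ * (limitWeight ρ *ᵥ u) p + δ * (limitWeight ρ *ᵥ w) p :=
    sub_eq_iff_eq_add'.1 (congrFun hu p)
  have hself (l : Blk (ρ : ℕ)) (a) : (limitMatrix ρ C E *ᵥ u) (Sum.inl ⟨ρ, (l, a)⟩) =
      μ * u (Sum.inl ⟨ρ, (l, a)⟩) + δ * μ ^ ((l : ℕ) - 1) * φ a := by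
    rw [hrow, limitWeight_mulVec_self, limitWeight_mulVec_self, hw, mul_assoc]
  have hchain := mul_chain_eq (μ := μ) (δ := δ) (φ := φ)
    (v := fun l a => u (Sum.inl ⟨ρ, (l, a)⟩)) rfl
    (fun l l' h => funext fun a => (limitMatrix_mulVec_self_of_succ h a).symm.trans (hself l a))
    (last ρ)
  have hschur := (schur_of_limitMatrix_mulVec hW hE (C := C) (u := u) fun c => by
    rw [hrow, limitWeight_mulVec_lastIdx_tailTail, limitWeight_mulVec_lastIdx_tailTail, mul_zero,
      mul_zero, add_zero]).2
  refine hschur.trans (funext fun a => (hself (last ρ) a).trans ?_)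
  have hlast := congrFun hchain a
  simp only [last, Pi.add_apply, Pi.smul_apply, smul_eq_mul] at hlast ⊢
  rw [hlast]
  simp only [Function.comp_apply, firstIdx, tailHead]
  ring

theorem isSimpleEigenpair_limit (hW : IsUnit (W Xi Sg D (ρ + 1)))
    (hE : E.submatrix (lastIdx ρ) (firstIdx ρ) = W Xi Sg D ρ) (hC : IsUnit C)
    {μ : ℂ} (hμ : μ ≠ 0) {φ : Fin (s ρ) → ℂ}
    (hS : IsSimpleEigenpair (S Xi Sg D ρ).mulVecLin 1 (μ ^ (ρ : ℕ)) φ)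
    {y : JIdx k s ⊕ κ → ℂ} (hy : limitMatrix ρ C E *ᵥ y = μ • (limitWeight ρ *ᵥ y))
    (hchain : ∀ (l : Blk (ρ : ℕ)) a, y (Sum.inl ⟨ρ, (l, a)⟩) = μ ^ ((l : ℕ) - 1) * φ a) :
    IsSimpleEigenpair (limitMatrix ρ C E).mulVecLin (limitWeight ρ).mulVecLin μ y where
  ne_zero := by
    rintro rfl
    refine hS.ne_zero (funext fun a => ?_)
    simpa [first] using (hchain (first ρ) a).symm
  map_eq := hy
  simple := by
    intro δ u hu
    have hρ : (ρ : ℕ) ≠ 0 := Nat.one_le_iff_ne_zero.1 (Finset.mem_Icc.1 ρ.2).1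
    have hschur := schur_eq_of_limit_eq hW hE hchain hu
    obtain ⟨hδ, α, hα⟩ := hS.simple _ _ (sub_eq_iff_eq_add'.2 hschur)
    obtain rfl : δ = 0 := by simpa [hμ, hρ] using hδ
    refine ⟨rfl, α, sub_eq_zero.1 (eq_zero_of_limit_rows hW hE hC hμ (fun p _ => ?_) ?_)⟩
    · have hp := congrFun (sub_eq_zero.1 (hu.trans (zero_smul ℂ _))) p
      have hyp := congrFun hy p
      simp only [mulVecLin_apply, mulVec_sub, mulVec_smul, Pi.sub_apply, Pi.smul_apply,
        smul_eq_mul] at hp hyp ⊢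
      linear_combination hp - α * hyp
    · have hhead : y ∘ firstIdx ρ ∘ tailHead ρ = φ := funext fun a =>
        (hchain (first ρ) a).trans (by simp [first])
      rw [Pi.sub_comp, hα, Pi.smul_comp, hhead, sub_self]

end Limit

section Branch

theorem isBigO_pow_mul_sub_pow_mul {𝕜 : Type*} [NormedField 𝕜] {f : 𝕜 → 𝕜} {a : 𝕜}
    (h : (fun τ => f τ - a) =O[𝓝 0] fun τ => τ) (e : ℕ) :
    (fun τ => τ ^ e * f τ - τ ^ e * a) =O[𝓝 0] fun τ => τ ^ (e + 1) := by
  simpa only [mul_sub, pow_succ] using (isBigO_refl (fun τ : 𝕜 => τ ^ e) (𝓝 0)).mul h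

theorem isBigO_pow_mul_sub_zero_pow_mul {𝕜 : Type*} [NormedField 𝕜] {f : 𝕜 → 𝕜} {a : 𝕜}
    (h : (fun τ => f τ - a) =O[𝓝 0] fun τ => τ) (e : ℕ) :
    (fun τ => τ ^ e * f τ - 0 ^ e * a) =O[𝓝 0] fun τ => τ ^ max 1 e := by
  rcases Nat.eq_zero_or_pos e with rfl | he
  · simpa using h
  · have hf : f =O[𝓝 0] fun _ => (1 : 𝕜) := by
      have hsub := (h.trans (tendsto_id.isBigO_one 𝕜)).add (isBigO_const_const a one_ne_zero _)
      simpa only [sub_add_cancel] using hsub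
    simpa [max_eq_right (Nat.succ_le_of_lt he), zero_pow he.ne'] using
      (isBigO_refl (fun τ : 𝕜 => τ ^ e) (𝓝 0)).mul hf

variable {n k : ℕ} {s : ℕ → ℕ} {κ : Type*}

theorem order_self (ρ l : ℕ) : order ρ ρ l = l := by
  simp [order]

theorem order_of_ne {ρ i : Blk k} (h : i ≠ ρ) (p : BIdx s i) :
    order ρ i p.1 = max 1 (coordOrder (κ := κ) ρ (Sum.inl ⟨i, p⟩)) := by
  have hρ := Finset.mem_Icc.1 ρ.2
  have hp := Finset.mem_Icc.1 p.1.2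
  have hne : (i : ℕ) ≠ ρ := mt Subtype.ext h
  rcases hne.lt_or_gt with hi | hi
  · rw [coordOrder_of_lt hi, order, if_pos hi]
    omega
  · rw [coordOrder_of_le hi.le, order, if_neg hi.not_gt, if_neg hne]
    split_ifs <;> omega

theorem lead_mul_apply {ρ : ℕ} (φ : Fin (s ρ) → ℂ) (τ μ : ℂ) (l : Blk ρ) (a : Fin (s ρ)) :
    lead ρ φ (τ * μ) l a = τ ^ ((l : ℕ) - 1) * (μ ^ ((l : ℕ) - 1) * φ a) -
      0 ^ ((l : ℕ) - 1) * (μ ^ ((l : ℕ) - 1) * φ a) := by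
  have hl := Finset.mem_Icc.1 l.2
  by_cases h : (l : ℕ) = 1
  · simp [lead, h]
  · simp [lead, h, zero_pow (show (l : ℕ) - 1 ≠ 0 by omega), mul_pow, mul_assoc]

theorem extend_firstIdx_apply {ρ : ℕ} (hρ : ρ ≠ 0) (y : JIdx k s ⊕ κ → ℂ) (q : JIdx k s ⊕ κ) :
    Function.extend (firstIdx ρ) (y ∘ firstIdx ρ) 0 q = 0 ^ coordOrder ρ q * y q := by
  by_cases hq : coordOrder ρ q = 0
  · obtain ⟨c, rfl⟩ := (coordOrder_eq_zero_iff hρ).1 hq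
    rw [(firstIdx_injective ρ).extend_apply, coordOrder_firstIdx, pow_zero, one_mul,
      Function.comp_apply]
  · rw [Function.extend_apply' _ _ _ (mt (coordOrder_eq_zero_iff hρ).2 hq), zero_pow hq, zero_mul,
      Pi.zero_apply]

variable [Fintype κ] [DecidableEq κ] {ρ : Blk k} {Xi Sg : Matrix (Fin n) (JIdx k s) ℂ}
  {D : Matrix (Fin n) (Fin n) ℂ} {C : Matrix κ κ ℂ}
  {E : Matrix (JIdx k s ⊕ κ) (JIdx k s ⊕ κ) ℂ} {μ : ℂ} {φ : Fin (s ρ) → ℂ}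

theorem exists_scaled_branch (hW : IsUnit (W Xi Sg D (ρ + 1)))
    (hE : E.submatrix (lastIdx ρ) (firstIdx ρ) = W Xi Sg D ρ) (hC : IsUnit C) (hμ : μ ≠ 0)
    (hS : IsSimpleEigenpair (S Xi Sg D ρ).mulVecLin 1 (μ ^ (ρ : ℕ)) φ) :
    ∃ (c : ℂ → ℂ) (y : ℂ → JIdx k s ⊕ κ → ℂ) (y₀ : JIdx k s ⊕ κ → ℂ),
      ((fun τ => c τ - μ) =O[𝓝 0] fun τ => τ) ∧
      ((fun τ => y τ - y₀) =O[𝓝 0] fun τ => τ) ∧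
      y₀ ∘ firstIdx ρ = stack ρ φ (G Xi Sg D ρ *ᵥ φ) ∧
      (∀ l a, y₀ (Sum.inl ⟨ρ, (l, a)⟩) = μ ^ ((l : ℕ) - 1) * φ a) ∧
      ∀ᶠ τ in 𝓝 0, (nilSum s C + τ ^ (ρ : ℕ) • E) *ᵥ
          (diagonal (fun q => τ ^ coordOrder ρ q) *ᵥ y τ) =
        (τ * c τ) • (diagonal (fun q => τ ^ coordOrder ρ q) *ᵥ y τ) ∧
        diagonal (fun q => τ ^ coordOrder ρ q) *ᵥ y τ ≠ 0 := by
  obtain ⟨y₀, heigen, hfirst, hchain⟩ := exists_limit_eigenvector hW hE hC hμ hS.map_eq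
  obtain ⟨a, ha⟩ := Function.ne_iff.1 hS.ne_zero
  have hy₀ : y₀ (firstIdx ρ (tailHead ρ a)) ≠ 0 := by
    rw [← Function.comp_apply (f := y₀), hfirst, stack_tailHead]
    exact ha
  obtain ⟨c, y, hc, hy, heq⟩ := exists_branch_of_scaled
    (coordOrder_eq_of_nilSum_ne_zero C ρ) (isSimpleEigenpair_limit hW hE hC hμ hS heigen hchain)
    (coordOrder_firstIdx ρ _) hy₀
  exact ⟨c, y, y₀, hc, hy, hfirst, hchain, heq⟩

theorem exists_branch_of_simple (hW : IsUnit (W Xi Sg D (ρ + 1)))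
    (hE : E.submatrix (lastIdx ρ) (firstIdx ρ) = W Xi Sg D ρ) (hC : IsUnit C) (hμ : μ ≠ 0)
    (hS : IsSimpleEigenpair (S Xi Sg D ρ).mulVecLin 1 (μ ^ (ρ : ℕ)) φ) :
    ∃ (ν : ℂ → ℂ) (z : ℂ → JIdx k s ⊕ κ → ℂ),
      (∀ᶠ τ in 𝓝 0, (nilSum s C + τ ^ (ρ : ℕ) • E) *ᵥ
          (Function.extend (firstIdx ρ) (stack ρ φ (G Xi Sg D ρ *ᵥ φ)) 0 + z τ) =
        ν τ • (Function.extend (firstIdx ρ) (stack ρ φ (G Xi Sg D ρ *ᵥ φ)) 0 + z τ) ∧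
        Function.extend (firstIdx ρ) (stack ρ φ (G Xi Sg D ρ *ᵥ φ)) 0 + z τ ≠ 0) ∧
      ((fun τ => ν τ - τ * μ) =O[𝓝 0] fun τ => τ ^ 2) ∧
      (∀ j, (fun τ => z τ (Sum.inr j)) =O[𝓝 0] fun τ => τ ^ (ρ : ℕ)) ∧
      (∀ l a, (fun τ => z τ (Sum.inl ⟨ρ, (l, a)⟩) - lead ρ φ (τ * μ) l a) =O[𝓝 0]
        fun τ => τ ^ order ρ ρ l) ∧
      ∀ i ≠ ρ, ∀ l a, (fun τ => z τ (Sum.inl ⟨i, (l, a)⟩)) =O[𝓝 0]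
        fun τ => τ ^ order ρ i l := by
  have hρ := Finset.mem_Icc.1 ρ.2
  obtain ⟨c, y, y₀, hc, hy, hfirst, hchain, heq⟩ := exists_scaled_branch hW hE hC hμ hS
  have hyq (q) : (fun τ => y τ q - y₀ q) =O[𝓝 0] fun τ => τ := isBigO_pi.1 hy q
  have hbase : Function.extend (firstIdx ρ) (stack ρ φ (G Xi Sg D ρ *ᵥ φ)) 0 =
      fun q => 0 ^ coordOrder ρ q * y₀ q := by
    ext q
    rw [← hfirst, extend_firstIdx_apply (by omega)]
  have hx (τ : ℂ) : (fun q => 0 ^ coordOrder ρ q * y₀ q) +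
      (fun q => τ ^ coordOrder ρ q * y τ q - 0 ^ coordOrder ρ q * y₀ q) =
      diagonal (fun q => τ ^ coordOrder ρ q) *ᵥ y τ := by
    ext q
    rw [mulVec_diagonal, Pi.add_apply, add_sub_cancel]
  have hz (q) := isBigO_pow_mul_sub_zero_pow_mul (hyq q) (coordOrder ρ q)
  refine ⟨fun τ => τ * c τ, fun τ q => τ ^ coordOrder ρ q * y τ q - 0 ^ coordOrder ρ q * y₀ q,
    ?_, ?_, fun j => ?_, fun l a => ?_, fun i hi l a => ?_⟩
  · simpa only [hbase, hx] using heq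
  · simpa only [pow_one] using isBigO_pow_mul_sub_pow_mul hc 1
  · simpa only [coordOrder_inr, max_eq_right hρ.1] using hz (Sum.inr j)
  · have h := isBigO_pow_mul_sub_pow_mul (hyq (Sum.inl ⟨ρ, (l, a)⟩)) ((l : ℕ) - 1)
    rw [Nat.sub_add_cancel (Finset.mem_Icc.1 l.2).1] at h
    rw [order_self]
    refine h.congr_left fun τ => ?_
    dsimp only
    rw [coordOrder_self, hchain, lead_mul_apply]
    ring
  · rw [order_of_ne (κ := κ) hi (l, a)]
    exact hz _

end Branch

section Transfer

/-- The real root `t ^ (1 / ρ)` of the perturbation parameter `t > 0`, embedded in `ℂ`; the branch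
is followed as a function of it. -/
noncomputable def root (ρ : ℕ) (t : ℝ) : ℂ := ((t ^ (1 / (ρ : ℝ)) : ℝ) : ℂ)

theorem tendsto_root {ρ : ℕ} (hρ : ρ ≠ 0) : Tendsto (root ρ) (𝓝[>] 0) (𝓝 0) := by
  have hpos : (0 : ℝ) < 1 / (ρ : ℝ) := by positivity
  have h := (Complex.continuous_ofReal.comp (Real.continuous_rpow_const hpos.le)).tendsto 0
  simp only [Function.comp_apply, Real.zero_rpow hpos.ne', Complex.ofReal_zero] at h
  exact h.mono_left nhdsWithin_le_nhds

theorem root_pow (ρ e : ℕ) {t : ℝ} (ht : 0 ≤ t) :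
    root ρ t ^ e = ((t ^ ((e : ℝ) / (ρ : ℝ)) : ℝ) : ℂ) := by
  rw [root, ← Complex.ofReal_pow, ← Real.rpow_natCast, ← Real.rpow_mul ht, one_div_mul_eq_div]

theorem root_pow_self {ρ : ℕ} (hρ : ρ ≠ 0) {t : ℝ} (ht : 0 ≤ t) : root ρ t ^ ρ = t := by
  rw [root_pow ρ ρ ht, div_self (Nat.cast_ne_zero.2 hρ), Real.rpow_one]

theorem isBigO_comp_root {F : Type*} [Norm F] {g : ℂ → F} {ρ e : ℕ} (hρ : ρ ≠ 0)
    (hg : g =O[𝓝 0] fun τ => τ ^ e) :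
    (fun t => g (root ρ t)) =O[𝓝[>] 0] fun t : ℝ => t ^ ((e : ℝ) / (ρ : ℝ)) := by
  refine (hg.comp_tendsto (tendsto_root hρ)).trans (IsBigO.of_norm_eventuallyLE ?_)
  filter_upwards [self_mem_nhdsWithin] with t (ht : 0 < t)
  rw [Function.comp_apply, root_pow ρ e ht.le, Complex.norm_real,
    Real.norm_of_nonneg (Real.rpow_nonneg ht.le _)]

theorem hasEigenvector_of_mul_eq {K V X : Type*} [Field K] [Fintype V] [DecidableEq V] [Fintype X]
    [DecidableEq X] {A : Matrix V V K} {P : Matrix V X K} {Q : Matrix X V K} {J : Matrix X X K}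
    {lam0 : K} (hQP : Q * P = 1) (hPQ : P * Q = 1) (hA : A * P = P * (lam0 • 1 + J))
    (D : Matrix V V K) {ε ν : K} {x : X → K} (hx : (J + ε • (Q * D * P)) *ᵥ x = ν • x)
    (hx0 : x ≠ 0) : Module.End.HasEigenvector (toLin' (A + ε • D)) (lam0 + ν) (P *ᵥ x) := by
  have hAD : (A + ε • D) * P = P * (lam0 • 1 + (J + ε • (Q * D * P))) := by
    have hD : P * (Q * D * P) = D * P := by
      rw [Matrix.mul_assoc, ← Matrix.mul_assoc, hPQ, Matrix.one_mul]
    rw [Matrix.add_mul, hA, ← add_assoc, Matrix.mul_add P _ (ε • _), Matrix.mul_smul, hD,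
      Matrix.smul_mul]
  refine ⟨Module.End.mem_eigenspace_iff.2 ?_, fun h => hx0 ?_⟩
  · rw [toLin'_apply, mulVec_mulVec, hAD, ← mulVec_mulVec, add_mulVec, hx, smul_mulVec,
      one_mulVec, ← add_smul, mulVec_smul]
  · rw [← one_mulVec x, ← hQP, ← mulVec_mulVec, h, mulVec_zero]

theorem isUnit_sub_smul_one {X : Type*} [Fintype X] [DecidableEq X] {B : Matrix X X ℂ} {lam0 : ℂ}
    (h : lam0 ∉ spectrum ℂ B) : IsUnit (B - lam0 • (1 : Matrix X X ℂ)) := by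
  rw [spectrum.notMem_iff, Algebra.algebraMap_eq_smul_one] at h
  rwa [← IsUnit.neg_iff, neg_sub]

variable {n m k : ℕ} {s : ℕ → ℕ}

theorem fromBlocks_eq_smul_one_add_nilSum (lam0 : ℂ) (A22 : Matrix (Fin m) (Fin m) ℂ) :
    fromBlocks (lam0 • (1 : Matrix (JIdx k s) (JIdx k s) ℂ) + nil k s) 0 0 A22 =
      lam0 • 1 + nilSum s (A22 - lam0 • 1) := by
  rw [nilSum, ← fromBlocks_one, fromBlocks_smul, fromBlocks_add]
  simp

variable (Xi : Matrix (Fin n) (JIdx k s) ℂ) (Xic : Matrix (Fin n) (Fin m) ℂ)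

theorem sum_colBlock_mulVec (x : JIdx k s → ℂ) :
    ∑ i, colBlock Xi i *ᵥ (fun p => x ⟨i, p⟩) = Xi *ᵥ x := by
  ext r
  rw [Finset.sum_apply]
  exact (Fintype.sum_sigma fun q => Xi r q * x q).symm

theorem tailFirst_mulVec (i : ℕ) (v : Tail k s i → ℂ) :
    tailFirst Xi i *ᵥ v = fromCols Xi Xic *ᵥ Function.extend (firstIdx i) v 0 := by
  ext r
  refine Fintype.sum_of_injective _ (firstIdx_injective i) _ _ (fun q hq => ?_) fun c => ?_
  · rw [Function.extend_apply' _ _ _ hq, Pi.zero_apply, mul_zero]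
  · rw [(firstIdx_injective i).extend_apply]
    rfl

theorem fromCols_mulVec_extend_add_sub (i : ℕ) (v : Tail k s i → ℂ) (z : JIdx k s ⊕ Fin m → ℂ) :
    fromCols Xi Xic *ᵥ (Function.extend (firstIdx i) v 0 + z) -
        (tailFirst Xi i *ᵥ v + ∑ j, colBlock Xi j *ᵥ fun p => z (Sum.inl ⟨j, p⟩)) =
      Xic *ᵥ (z ∘ Sum.inr) := by
  have hsum : ∑ j, colBlock Xi j *ᵥ (fun p => z (Sum.inl ⟨j, p⟩)) = Xi *ᵥ (z ∘ Sum.inl) :=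
    sum_colBlock_mulVec Xi (z ∘ Sum.inl)
  rw [tailFirst_mulVec Xi Xic, mulVec_add, hsum, fromCols_mulVec _ _ z]
  abel

end Transfer

end JordanPert

open JordanPert in
theorem corollary3p3_general
    (n m k : ℕ) (s : ℕ → ℕ)
    (A D : Matrix (Fin n) (Fin n) ℂ) (lam0 : ℂ)
    (Xi Sg : Matrix (Fin n) (JIdx k s) ℂ) (Xic Sgc : Matrix (Fin n) (Fin m) ℂ)
    (hinv : (fromCols Sg Sgc)ᴴ * fromCols Xi Xic = 1)
    (hinv' : fromCols Xi Xic * (fromCols Sg Sgc)ᴴ = 1)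
    (A22 : Matrix (Fin m) (Fin m) ℂ)
    (hA : A * fromCols Xi Xic =
      fromCols Xi Xic *
        fromBlocks (lam0 • (1 : Matrix (JIdx k s) (JIdx k s) ℂ) + nil k s) 0 0 A22)
    (hA22 : lam0 ∉ spectrum ℂ A22)
    (ρ : Blk k)
    (hW' : (ρ : ℕ) < k → IsUnit (W Xi Sg D ((ρ : ℕ) + 1)))
    (γ : ℂ) (hγ0 : γ ≠ 0) (hγ : (S Xi Sg D ρ).charpoly.rootMultiplicity γ = 1)
    (φ : Fin (s ρ) → ℂ) (hφ0 : φ ≠ 0) (hφ : S Xi Sg D ρ *ᵥ φ = γ • φ)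
    (μ : ℂ) (hμ : μ ^ (ρ : ℕ) = γ) :
    ∃ (lam : ℝ → ℂ) (h : ℝ → Fin n → ℂ)
      (hb : (i : Blk k) → ℝ → BIdx s (i : ℕ) → ℂ),
      (∀ᶠ t : ℝ in 𝓝[>] 0,
        Module.End.HasEigenvector (Matrix.toLin' (A + (t : ℂ) • D)) (lam t) (h t)) ∧
      ((fun t : ℝ => lam t - (lam0 + ((t ^ (1 / ((ρ : ℕ) : ℝ)) : ℝ) : ℂ) * μ))
        =O[𝓝[>] 0] fun t : ℝ => t ^ (2 / ((ρ : ℕ) : ℝ))) ∧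
      ((fun t : ℝ => h t -
          (tailFirst Xi (ρ : ℕ) *ᵥ stack ρ φ (G Xi Sg D ρ *ᵥ φ)
            + ∑ i : Blk k, colBlock Xi i *ᵥ hb i t))
        =O[𝓝[>] 0] fun t : ℝ => t) ∧
      (∀ l : Blk (ρ : ℕ),
        (fun (t : ℝ) (a : Fin (s ρ)) => hb ρ t (l, a) -
            lead (ρ : ℕ) φ (((t ^ (1 / ((ρ : ℕ) : ℝ)) : ℝ) : ℂ) * μ) l a)
          =O[𝓝[>] 0] fun t : ℝ =>
            t ^ ((order (ρ : ℕ) (ρ : ℕ) (l : ℕ) : ℝ) / ((ρ : ℕ) : ℝ))) ∧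
      (∀ i : Blk k, i ≠ ρ → ∀ l : Blk (i : ℕ),
        (fun (t : ℝ) (a : Fin (s i)) => hb i t (l, a))
          =O[𝓝[>] 0] fun t : ℝ =>
            t ^ ((order (ρ : ℕ) (i : ℕ) (l : ℕ) : ℝ) / ((ρ : ℕ) : ℝ))) := by
  subst hμ
  have hρ : (ρ : ℕ) ≠ 0 := Nat.one_le_iff_ne_zero.1 (Finset.mem_Icc.1 ρ.2).1
  have hS : IsSimpleEigenpair (S Xi Sg D ρ).mulVecLin 1 (μ ^ (ρ : ℕ)) φ :=
    isSimpleEigenpair_of_rootMultiplicity_charpoly_eq_one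
      (by rwa [charpoly_mulVecLin]) ⟨Module.End.mem_eigenspace_iff.2 hφ, hφ0⟩
  obtain ⟨ν, z, heigen, hν, hzc, hzρ, hzi⟩ := exists_branch_of_simple
    (E := (fromCols Sg Sgc)ᴴ * D * fromCols Xi Xic) (isUnit_W_succ hW') rfl
    (isUnit_sub_smul_one hA22) ((pow_ne_zero_iff hρ).1 hγ0) hS
  rw [fromBlocks_eq_smul_one_add_nilSum] at hA
  refine ⟨fun t => lam0 + ν (root ρ t), fun t => fromCols Xi Xic *ᵥ
      (Function.extend (firstIdx ρ) (stack ρ φ (G Xi Sg D ρ *ᵥ φ)) 0 + z (root ρ t)),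
    fun i t p => z (root ρ t) (Sum.inl ⟨i, p⟩), ?_, ?_, ?_, fun l => ?_, fun i hi l => ?_⟩
  · filter_upwards [(tendsto_root hρ).eventually heigen, self_mem_nhdsWithin] with t ⟨hx, hx0⟩ ht
    rw [root_pow_self hρ (le_of_lt ht)] at hx
    exact hasEigenvector_of_mul_eq hinv hinv' hA D hx hx0
  · simpa only [add_sub_add_left_eq_sub, root, Nat.cast_ofNat] using isBigO_comp_root hρ hν
  · have hmul : (fun τ => Xic *ᵥ (z τ ∘ Sum.inr)) =O[𝓝 0] fun τ => τ ^ (ρ : ℕ) :=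
      ((mulVecLin Xic).toContinuousLinearMap.isBigO_comp _ _).trans (isBigO_pi.2 hzc)
    simpa only [fromCols_mulVec_extend_add_sub, div_self (Nat.cast_ne_zero.2 hρ : (ρ : ℝ) ≠ 0),
      Real.rpow_one] using isBigO_comp_root hρ hmul
  · exact isBigO_comp_root hρ (isBigO_pi.2 (hzρ l))
  · exact isBigO_comp_root hρ (isBigO_pi.2 (hzi i hi l))

theorem corollary3p3
    (n m k : ℕ) (s : ℕ → ℕ) (hs : 0 < s k)
    (A D : Matrix (Fin n) (Fin n) ℂ) (lam0 : ℂ)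
    -- `[Ξ, Ξ_c]` is invertible and `[Σ, Σ_c]` is its inverse conjugate transpose
    (Xi Sg : Matrix (Fin n) (JordanPert.JIdx k s) ℂ) (Xic Sgc : Matrix (Fin n) (Fin m) ℂ)
    (hinv : (Matrix.fromCols Sg Sgc)ᴴ * Matrix.fromCols Xi Xic = 1)
    (hinv' : Matrix.fromCols Xi Xic * (Matrix.fromCols Sg Sgc)ᴴ = 1)
    -- `A [Ξ, Ξ_c] = [Ξ, Ξ_c] diag (λ₀ I + N, A₂₂)` with `λ₀` not an eigenvalue of `A₂₂`
    (A22 : Matrix (Fin m) (Fin m) ℂ)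
    (hA : A * Matrix.fromCols Xi Xic =
      Matrix.fromCols Xi Xic *
        Matrix.fromBlocks (lam0 • (1 : Matrix (JordanPert.JIdx k s) (JordanPert.JIdx k s) ℂ)
          + JordanPert.nil k s) 0 0 A22)
    (hA22 : lam0 ∉ spectrum ℂ A22)
    (ρ : JordanPert.Blk k)
    (hW : ∀ i : ℕ, 1 ≤ i → i ≤ (ρ : ℕ) → IsUnit (JordanPert.W Xi Sg D i))
    (hW' : (ρ : ℕ) < k → IsUnit (JordanPert.W Xi Sg D ((ρ : ℕ) + 1)))
    (γ : ℂ) (hγ : (JordanPert.S Xi Sg D ρ).charpoly.rootMultiplicity γ = 1)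
    (φ : Fin (s ρ) → ℂ) (hφ0 : φ ≠ 0) (hφ : JordanPert.S Xi Sg D ρ *ᵥ φ = γ • φ)
    (μ : ℂ) (hμ : μ ^ (ρ : ℕ) = γ) :
    ∃ (lam : ℝ → ℂ) (h : ℝ → Fin n → ℂ)
      (hb : (i : JordanPert.Blk k) → ℝ → JordanPert.BIdx s (i : ℕ) → ℂ),
      (∀ᶠ t : ℝ in 𝓝[>] 0,
        Module.End.HasEigenvector (Matrix.toLin' (A + (t : ℂ) • D)) (lam t) (h t)) ∧
      ((fun t : ℝ => lam t - (lam0 + ((t ^ (1 / ((ρ : ℕ) : ℝ)) : ℝ) : ℂ) * μ))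
        =O[𝓝[>] 0] fun t : ℝ => t ^ (2 / ((ρ : ℕ) : ℝ))) ∧
      ((fun t : ℝ => h t -
          (JordanPert.tailFirst Xi (ρ : ℕ) *ᵥ
              JordanPert.stack ρ φ (JordanPert.G Xi Sg D ρ *ᵥ φ)
            + ∑ i : JordanPert.Blk k, JordanPert.colBlock Xi i *ᵥ hb i t))
        =O[𝓝[>] 0] fun t : ℝ => t) ∧
      (∀ l : JordanPert.Blk (ρ : ℕ),
        (fun (t : ℝ) (a : Fin (s ρ)) => hb ρ t (l, a) -
            JordanPert.lead (ρ : ℕ) φ (((t ^ (1 / ((ρ : ℕ) : ℝ)) : ℝ) : ℂ) * μ) l a)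
          =O[𝓝[>] 0] fun t : ℝ =>
            t ^ ((JordanPert.order (ρ : ℕ) (ρ : ℕ) (l : ℕ) : ℝ) / ((ρ : ℕ) : ℝ))) ∧
      (∀ i : JordanPert.Blk k, i ≠ ρ → ∀ l : JordanPert.Blk (i : ℕ),
        (fun (t : ℝ) (a : Fin (s i)) => hb i t (l, a))
          =O[𝓝[>] 0] fun t : ℝ =>
            t ^ ((JordanPert.order (ρ : ℕ) (i : ℕ) (l : ℕ) : ℝ) / ((ρ : ℕ) : ℝ))) :=
  corollary3p3_general n m k s A D lam0 Xi Sg Xic Sgc hinv hinv' A22 hA hA22 ρ hW' γ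
    (JordanPert.S_eigenvalue_ne_zero (hW ρ (Finset.mem_Icc.1 ρ.2).1 le_rfl)
      (JordanPert.isUnit_W_succ hW') hφ0 hφ) hγ φ hφ0 hφ μ hμ
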